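/- Let $p$ be a prime, let $G$ be a finite $p$-group and let $A\le\operatorname{Aut}(G)$ be a group of automorphisms of $G$. In the semidirect product of $G$ and $A$ write $[x,y]=x^{-1}y^{-1}xy$, and define left normed commutators by $[x_1]=x_1$ and $[x_1,\dots,x_m]=[[x_1,\dots,x_{m-1}],x_m]$. Let $[G,A]$ be the subgroup of $G$ generated by all $[g,a]$ with $g\in G$, $a\in A$. For $k\ge 1$ let $\gamma_k(G,A)$ be the subgroup of $G$ generated by all left normed commutators $[x_1,\dots,x_m]$, $m\ge k$, with all $x_i\in G\cup A$, with $x_1\in G$, and with at least $k-1$ of the $x_i$ lying in $A$. Suppose that $A$ acts $p$-centrally on $\gamma_p(G,A)$, that is, $A$ fixes every element of $\gamma_p(G,A)$ whose order divides $p$ (divides $4$ if $p=2$). Then: (i) for every positive integer $i$, the elements of $[G,A]$ of order dividing $p^i$ form a subgroup; (ii) for every positive integer $i$, the elements of $A$ of order dividing $p^i$ form a subgroup; (iii) $\exp([G,A])=\exp(A)$; (iv) $\exp(A)=p^n$ for some integer $n\ge 0$, and both $A$ and $[G,A]$ are nilpotent of class at most $n+p-2$. -/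

import Mathlib

/-- Let the group `A` act on the group `G` by automorphisms. Inside the semidirect product of `G`
and `A`, consider the left normed commutators `[x₁, x₂, …, xₙ] = [[x₁, …, xₙ₋₁], xₙ]` with
`x₁ ∈ G` and every other `xᵢ` in `G` or in `A`, where `[x, y] = x⁻¹ * x ^ y`. They all lie in `G`.
`IsLeftNormedCommutator A j c` says that `c` is such a commutator with exactly `j` entries
taken from `A`. -/
inductive IsLeftNormedCommutator {G : Type*} [Group G] (A : Type*) [Group A]
    [MulDistribMulAction A G] : ℕ → G → Prop
  | base (g : G) : IsLeftNormedCommutator A 0 g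
  | commGroup {j : ℕ} {c : G} (h : IsLeftNormedCommutator A j c) (g : G) :
      IsLeftNormedCommutator A j (c⁻¹ * (g⁻¹ * c * g))
  | commAction {j : ℕ} {c : G} (h : IsLeftNormedCommutator A j c) (a : A) :
      IsLeftNormedCommutator A (j + 1) (c⁻¹ * (a • c))

/-- `γ_k(G, A)` for `k ≥ 1`: the subgroup of `G` generated by all the left normed commutators with
first entry in `G`, all entries in `G ∪ A`, and at least `k - 1` entries in `A`
(such a commutator automatically has length at least `k`). -/
def gammaAction (k : ℕ) (G : Type*) [Group G] (A : Type*) [Group A]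
    [MulDistribMulAction A G] : Subgroup G :=
  Subgroup.closure {c : G | ∃ j : ℕ, k ≤ j + 1 ∧ IsLeftNormedCommutator A j c}

/-- `[G, A]`: the subgroup of `G` generated by all the `[g, a] = g⁻¹ * g ^ a`. -/
def commutatorAction (G : Type*) [Group G] (A : Type*) [Group A]
    [MulDistribMulAction A G] : Subgroup G :=
  Subgroup.closure {c : G | ∃ (g : G) (a : A), c = g⁻¹ * (a • g)}

/-- `A` acts `p`-centrally on the subgroup `H` of `G`: it fixes every element of `H` whose order
divides `p` (divides `4` if `p = 2`). -/
def ActsPCentrallyOn (p : ℕ) {G : Type*} [Group G] (A : Type*) [Group A]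
    [MulDistribMulAction A G] (H : Subgroup G) : Prop :=
  ∀ x ∈ H, orderOf x ∣ (if p = 2 then 4 else p) → ∀ a : A, a • x = x

/-! Inside the semidirect product of `G` and `A`, everything rests on one power criterion. For `a ∈
A` put `T = ⟨a⟩[G,A]`; if `x, y ∈ T` lie in the same coset of `[G,A]`, then `x ^ p ^ i = y ^ p ^ i`
iff `(x⁻¹ * y) ^ p ^ i = 1`. With `x, y ∈ [G,A]` this is (i). Applied to `a⁻¹` and its conjugate by
`g`, it says that `a ^ p ^ i` fixes `g` iff `[a,g]` has order dividing `p ^ i`; faithfulness then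
gives (ii) and (iii). Applied to `x⁻¹` and its conjugate by `a`, it shows that each commutation with
`A` beyond `γ_p(G,A)` lowers the exponent by a factor `p`, so the series of action commutators dies
after `n` further steps, which bounds both classes.

For odd `p` and `i = 1` the criterion comes from a minimal counterexample: it reduces to a
two-generator group of class less than `p` whose derived subgroup has exponent `p`, where `p`-th
powers are multiplicative (`mul_pow_prime_of_lowerCentralSeries_eq_bot`). Larger `i` follow by
factoring out the elements of order dividing `p` (`IsPCentralPair.quotient`). -/

open scoped commutatorElement

/-! ### Commutators of terms of the lower central series -/

namespace Subgroup

variable {G : Type*} [Group G]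

/-- The three subgroups lemma modulo a normal subgroup. -/
theorem commutator_commutator_le_of_rotate {H₁ H₂ H₃ N : Subgroup G} [N.Normal]
    (h1 : ⁅⁅H₂, H₃⁆, H₁⁆ ≤ N) (h2 : ⁅⁅H₃, H₁⁆, H₂⁆ ≤ N) : ⁅⁅H₁, H₂⁆, H₃⁆ ≤ N := by
  have key : ∀ H : Subgroup G, H ≤ N ↔ H.map (QuotientGroup.mk' N) = ⊥ := fun H => by
    rw [map_eq_bot_iff, QuotientGroup.ker_mk']
  rw [key] at h1 h2 ⊢
  simp only [map_commutator] at h1 h2 ⊢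
  exact commutator_commutator_eq_bot_of_rotate h1 h2

theorem commutator_lowerCentralSeries_le (i j : ℕ) :
    ⁅(⊤ : Subgroup G).lowerCentralSeries i, (⊤ : Subgroup G).lowerCentralSeries j⁆ ≤
      (⊤ : Subgroup G).lowerCentralSeries (i + j + 1) := by
  induction j generalizing i with
  | zero => exact le_rfl
  | succ j ih =>
    rw [commutator_comm, lowerCentralSeries_succ]
    refine commutator_commutator_le_of_rotate ?_ ?_
    · rw [commutator_comm ⊤, ← lowerCentralSeries_succ]
      exact (ih (i + 1)).trans (by rw [show i + 1 + j + 1 = i + (j + 1) + 1 by omega])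
    · exact commutator_mono (ih i) le_rfl

end Subgroup

/-! ### Polynomial sequences and multiplicativity of `p`-th powers -/

section PolynomialSequence

variable {L : Type*} [Group L]

/-- The smallest family of sets of sequences in `L`, indexed by a weight, which contains the
binomial powers `n ↦ g ^ (n.choose j)` of the elements `g` of the filtration `F`, and is
closed under products, inverses and weighted commutators. -/
inductive IsPolynomialSequence (F : ℕ → Subgroup L) : ℕ → (ℕ → L) → Prop
  | binomial {g : L} {i : ℕ} (hg : g ∈ F i) (j k : ℕ) (h : j + k = i) :
      IsPolynomialSequence F k (fun n => g ^ n.choose j)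
  | mul {k : ℕ} {f g : ℕ → L} (hf : IsPolynomialSequence F k f)
      (hg : IsPolynomialSequence F k g) : IsPolynomialSequence F k (f * g)
  | inv {k : ℕ} {f : ℕ → L} (hf : IsPolynomialSequence F k f) : IsPolynomialSequence F k f⁻¹
  | comm {i j : ℕ} {f g : ℕ → L} (hf : IsPolynomialSequence F i f)
      (hg : IsPolynomialSequence F j g) : IsPolynomialSequence F (i + j) ⁅f, g⁆
  | weaken {k : ℕ} {f : ℕ → L} (hf : IsPolynomialSequence F (k + 1) f) :
      IsPolynomialSequence F k f

namespace IsPolynomialSequence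

variable {F : ℕ → Subgroup L} {f g u : ℕ → L} {i j k l m n : ℕ}

theorem mono (hf : IsPolynomialSequence F l f) (h : k ≤ l) : IsPolynomialSequence F k f := by
  induction l, h using Nat.le_induction with
  | base => exact hf
  | succ l _ ih => exact ih hf.weaken

theorem one (k : ℕ) : IsPolynomialSequence F k (1 : ℕ → L) := by
  have := binomial (F := F) (F k).one_mem 0 k (zero_add k)
  simp only [one_pow] at this
  exact this

theorem comm_right (hf : IsPolynomialSequence F i f) (hg : IsPolynomialSequence F k g) :
    IsPolynomialSequence F k ⁅f, g⁆ :=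
  (hf.comm hg).mono (Nat.le_add_left k i)

theorem conj (hf : IsPolynomialSequence F i f) (hg : IsPolynomialSequence F k g) :
    IsPolynomialSequence F k (f * g * f⁻¹) := by
  have := (hf.comm_right hg).mul hg
  simpa [commutatorElement_def] using this

theorem mem (hanti : Antitone F) (hcomm : ∀ i j, ⁅F i, F j⁆ ≤ F (i + j))
    (hf : IsPolynomialSequence F k f) (n : ℕ) : f n ∈ F k := by
  induction hf with
  | binomial hg j k h => exact pow_mem (hanti (by omega) hg) _
  | mul _ _ h1 h2 => exact mul_mem h1 h2
  | inv _ h => exact inv_mem h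
  | comm _ _ h1 h2 => exact hcomm _ _ (Subgroup.commutator_mem_commutator h1 h2)
  | weaken _ h => exact hanti (Nat.le_succ _) h

/-- The multiplicative differences of a polynomial sequence form a polynomial sequence of
larger weight. -/
theorem exists_shift (hf : IsPolynomialSequence F k f) :
    ∃ u, IsPolynomialSequence F (k + 1) u ∧ (fun n => f (n + 1)) = u * f := by
  induction hf with
  | @binomial g i hg j k h =>
    cases j with
    | zero => exact ⟨1, one _, by ext n; simp⟩
    | succ j =>
      refine ⟨_, binomial hg j (k + 1) (by omega), ?_⟩
      ext n
      simp [Nat.choose_succ_succ, pow_add]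
  | @mul k f g hf hg h1 h2 =>
    obtain ⟨u, hu, hfu⟩ := h1
    obtain ⟨v, hv, hgv⟩ := h2
    refine ⟨u * (f * v * f⁻¹), hu.mul (hf.conj hv), ?_⟩
    have : (fun n => (f * g) (n + 1)) = (fun n => f (n + 1)) * fun n => g (n + 1) := rfl
    rw [this, hfu, hgv]
    group
  | @inv k f hf h =>
    obtain ⟨u, hu, hfu⟩ := h
    refine ⟨f⁻¹ * u⁻¹ * f⁻¹⁻¹, hf.inv.conj hu.inv, ?_⟩
    have : (fun n => f⁻¹ (n + 1)) = (fun n => f (n + 1))⁻¹ := rfl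
    rw [this, hfu]
    group
  | @comm i j f g hf hg h1 h2 =>
    obtain ⟨u, hu, hfu⟩ := h1
    obtain ⟨v, hv, hgv⟩ := h2
    have hc := hf.comm hg
    -- Expansion of `⁅u * f, v * g⁆ * ⁅f, g⁆⁻¹`: every factor is a conjugate of a commutator
    -- involving `u` or `v`, hence has weight at least `i + j + 1`.
    refine ⟨(u * ⁅f, v⁆ * u⁻¹) * ((u * ⁅v, ⁅f, g⁆⁆ * u⁻¹) * ⁅u, ⁅f, g⁆⁆) *
      (⁅f, g⁆ * ⁅u, v * g⁆ * ⁅f, g⁆⁻¹), ?_, ?_⟩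
    · refine ((hu.conj (hf.comm hv)).mul ((hu.conj ?_).mul ?_)).mul (hc.conj ?_)
      · exact (hv.comm hc).mono (by omega)
      · exact (hu.comm hc).mono (by omega)
      · exact (hu.comm (hv.weaken.mul hg)).mono (by omega)
    · have : (fun n => ⁅f, g⁆ (n + 1)) = ⁅fun n => f (n + 1), fun n => g (n + 1)⁆ := rfl
      rw [this, hfu, hgv]
      simp only [commutatorElement_def]
      group
  | weaken _ h =>
    obtain ⟨u, hu, hfu⟩ := h
    exact ⟨u, hu.weaken, hfu⟩

/-- Each passage to differences raises the weight by one and removes one of the leading trivial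
values. -/
theorem mem_of_forall_lt (hanti : Antitone F) (hcomm : ∀ i j, ⁅F i, F j⁆ ≤ F (i + j))
    (hf : IsPolynomialSequence F k f) (h1 : ∀ n < m, f n = 1) : f m ∈ F (k + m) := by
  induction m generalizing f k with
  | zero => exact hf.mem hanti hcomm 0
  | succ m ih =>
    obtain ⟨u, hu, hfu⟩ := hf.exists_shift
    have hval : ∀ n ≤ m, f (n + 1) = u n := fun n hn => by
      have := congrFun hfu n
      simpa [h1 n (by omega)] using this
    rw [hval m le_rfl, show k + (m + 1) = k + 1 + m by omega]
    exact ih hu fun n hn => by rw [← hval n hn.le, h1 _ (by omega)]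

end IsPolynomialSequence

/-- A polynomial sequence with trivial values at `0` and `1` is trivial at `p`, provided that the
`p`-th term of the filtration is trivial and the second one has exponent `p`. -/
theorem IsPolynomialSequence.eq_one_at_prime {F : ℕ → Subgroup L} {p : ℕ} (hp : p.Prime)
    (hanti : Antitone F) (hcomm : ∀ i j, ⁅F i, F j⁆ ≤ F (i + j)) (hbot : F p = ⊥)
    (hexp : ∀ z ∈ F 2, z ^ p = 1) {f : ℕ → L} (hf : IsPolynomialSequence F 0 f)
    (h0 : f 0 = 1) (h1 : f 1 = 1) : f p = 1 := by
  suffices H : ∀ d m, m + d = p → 2 ≤ m → ∀ f : ℕ → L, IsPolynomialSequence F 0 f →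
      (∀ n < m, f n = 1) → f p = 1 from
    H (p - 2) 2 (by have := hp.two_le; omega) le_rfl f hf fun n hn => by
      interval_cases n <;> assumption
  intro d
  induction d with
  | zero =>
    rintro m rfl - f hf hm
    have := hf.mem_of_forall_lt hanti hcomm hm
    rw [zero_add] at this
    simpa using hbot.le this
  | succ d ih =>
    intro m hmd hm f hf hfm
    have hg := hf.mem_of_forall_lt hanti hcomm hfm
    rw [zero_add] at hg
    set g := f m with hgdef
    -- Dividing by `n ↦ g ^ n.choose m` kills the value at `m`; the value at `p` does not change
    -- because `p` divides `p.choose m`.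
    have hpow : g ^ p.choose m = 1 := by
      obtain ⟨c, hc⟩ := hp.dvd_choose_self (k := m) (by omega) (by omega)
      rw [hc, pow_mul, hexp g (hanti hm hg), one_pow]
    have := ih (m + 1) (by omega) (by omega) _
      (hf.mul (IsPolynomialSequence.binomial hg m 0 (add_zero m)).inv) fun n hn => by
        rcases Nat.lt_succ_iff_lt_or_eq.1 hn with h | rfl
        · simp [hfm n h, Nat.choose_eq_zero_of_lt h]
        · simp [hgdef]
    simpa [hpow] using this

/-- In a group of class less than `p` whose derived subgroup has exponent `p`, taking `p`-th
powers is multiplicative. -/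
theorem mul_pow_prime_of_lowerCentralSeries_eq_bot {p : ℕ} (hp : p.Prime)
    (hbot : (⊤ : Subgroup L).lowerCentralSeries (p - 1) = ⊥)
    (hexp : ∀ z ∈ commutator L, z ^ p = 1) (x y : L) : (x * y) ^ p = x ^ p * y ^ p := by
  -- Truncated subtraction makes `F 0 = F 1 = ⊤`, so `F i` is `γ_i(L)` for `i ≥ 1`.
  let F : ℕ → Subgroup L := fun i => (⊤ : Subgroup L).lowerCentralSeries (i - 1)
  have hanti : Antitone F := fun i j h =>
    Subgroup.lowerCentralSeries_antitone _ (Nat.sub_le_sub_right h 1)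
  have hcomm : ∀ i j, ⁅F i, F j⁆ ≤ F (i + j) := fun i j => by
    rcases i with _ | i
    · simpa [F] using Subgroup.commutator_le_right _ _
    rcases j with _ | j
    · simpa [F] using Subgroup.commutator_le_left _ _
    simpa [F, show i + 1 + (j + 1) - 1 = i + j + 1 by omega] using
      Subgroup.commutator_lowerCentralSeries_le i j
  have hb : ∀ z : L, IsPolynomialSequence F 0 (fun n => z ^ n.choose 1) := fun z =>
    .binomial (i := 1) (by simp [F]) 1 0 rfl
  have := IsPolynomialSequence.eq_one_at_prime hp hanti hcomm hbot
    (fun z hz => hexp z hz) (((hb (x * y)).inv.mul (hb x)).mul (hb y)) (by simp) (by simp)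
  simp only [Pi.mul_apply, Pi.inv_apply, Nat.choose_one_right] at this
  rw [mul_assoc, inv_mul_eq_one] at this
  exact this

end PolynomialSequence

/-! ### When two elements have equal `p ^ i`-th powers -/

section PowerInjectivity

/-- `K` contains the derived subgroup of `L`, and the elements of order dividing `p` (dividing `4`
if `p = 2`) of `K ∩ γ_{p-1}(L)` are central in `L`. -/
structure IsPCentralPair (p : ℕ) {L : Type*} [Group L] (K : Subgroup L) : Prop where
  commutator_le : commutator L ≤ K
  mem_center : ∀ z ∈ K, z ∈ (⊤ : Subgroup L).lowerCentralSeries (p - 2) →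
    z ^ (if p = 2 then 4 else p) = 1 → z ∈ Subgroup.center L

variable {p : ℕ} {L : Type*} [Group L]

/-- A group generated by two elements, one of which lies in a proper normal subgroup `M`. If the
elements of order dividing `p` form a subgroup of `M` containing `⁅x, y⁆`, then they contain
the derived subgroup. -/
theorem pow_eq_one_of_mem_commutator {x y : L} (hxy : Subgroup.closure {x, y} = ⊤)
    {M : Subgroup L} [M.Normal] (hM : ∀ u ∈ M, ∀ v ∈ M, u ^ p = 1 → v ^ p = 1 → (u * v) ^ p = 1)
    (hmem : ⁅x, y⁆ ∈ M) (hpow : ⁅x, y⁆ ^ p = 1) : ∀ z ∈ commutator L, z ^ p = 1 := by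
  let Ω : Subgroup L :=
    { carrier := {z | z ∈ M ∧ z ^ p = 1}
      one_mem' := ⟨one_mem _, one_pow _⟩
      mul_mem' := fun hu hv => ⟨mul_mem hu.1 hv.1, hM _ hu.1 _ hv.1 hu.2 hv.2⟩
      inv_mem' := fun hu => ⟨inv_mem hu.1, by rw [inv_pow, hu.2, inv_one]⟩ }
  have : Ω.Normal := ⟨fun z hz g => ⟨Subgroup.Normal.conj_mem inferInstance z hz.1 g, by
    rw [conj_pow, hz.2, mul_one, mul_inv_cancel]⟩⟩
  have hΩ : commutator L ≤ Ω := by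
    rw [commutator_def, Subgroup.commutator_le]
    have hq : ∀ a b : L, ⁅a, b⁆ ∈ Ω ↔ Commute (a : L ⧸ Ω) (b : L ⧸ Ω) := fun a b => by
      rw [← commutatorElement_eq_one_iff_commute, ← QuotientGroup.eq_one_iff]
      rfl
    have hc : Commute (x : L ⧸ Ω) (y : L ⧸ Ω) := (hq x y).1 ⟨hmem, hpow⟩
    have key : ∀ b : L, Commute (x : L ⧸ Ω) b → Commute (y : L ⧸ Ω) b → ∀ a : L,
        Commute (a : L ⧸ Ω) b := fun b hx hy a => by
      have ha : a ∈ Subgroup.closure {x, y} := hxy ▸ Subgroup.mem_top a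
      induction ha using Subgroup.closure_induction with
      | mem c hc => rcases hc with rfl | rfl <;> assumption
      | one => exact Commute.one_left _
      | mul c d _ _ h1 h2 => exact h1.mul_left h2
      | inv c _ h => exact h.inv_left
    exact fun a _ b _ => (hq a b).2 (key b (key x (.refl _) hc.symm b).symm
      (key y hc (.refl _) b).symm a)
  exact fun z hz => (hΩ hz).2

/-- The situation of an odd prime: in a finite `p`-group in which the elements of order `p` of
`γ_{p-1}` are central, `x ^ p = y ^ p` if and only if `(x⁻¹ * y) ^ p = 1`. -/
theorem pow_prime_eq_iff_of_odd [hp : Fact p.Prime] (h2 : p ≠ 2) [Finite L] (hL : IsPGroup p L)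
    (hcen : ∀ z ∈ (⊤ : Subgroup L).lowerCentralSeries (p - 2), z ^ p = 1 → z ∈ Subgroup.center L)
    (x y : L) : x ^ p = y ^ p ↔ (x⁻¹ * y) ^ p = 1 := by
  induction hn : Nat.card L using Nat.strong_induction_on generalizing L with
  | _ n ih =>
  have hp3 : 3 ≤ p := by
    have := hp.out.two_le
    omega
  have hsub : ∀ M : Subgroup L, M ≠ ⊤ → ∀ u ∈ M, ∀ v ∈ M,
      (u ^ p = v ^ p ↔ (u⁻¹ * v) ^ p = 1) := fun M hM u hu v hv => by
    have := ih (Nat.card M) (by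
        rw [← hn]
        exact lt_of_le_of_ne (Subgroup.card_le_card_group M)
          fun h => hM (Subgroup.eq_top_of_card_eq _ h)) (L := M) (hL.to_subgroup M)
        (fun z hz hzp => by
          have hz' : (z : L) ∈ Subgroup.center L := by
            refine hcen _ ?_ (by rw [← Subgroup.coe_pow, hzp, Subgroup.coe_one])
            have : (z : L) ∈ ((⊤ : Subgroup M).lowerCentralSeries (p - 2)).map M.subtype :=
              ⟨z, hz, rfl⟩
            rw [Subgroup.map_lowerCentralSeries] at this
            exact Subgroup.lowerCentralSeries_mono _ le_top this
          rw [Subgroup.mem_center_iff] at hz' ⊢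
          exact fun g => Subtype.ext (hz' g)) ⟨u, hu⟩ ⟨v, hv⟩ rfl
    simpa [Subtype.ext_iff] using this
  -- in the two-generator case, the power map is multiplicative
  have hgen : ∀ a b : L, Subgroup.closure {a, b} = ⊤ → a ^ p = (b * a * b⁻¹) ^ p →
      ∀ u v : L, (u * v) ^ p = u ^ p * v ^ p := fun a b hab hpow => by
    by_cases ha : Subgroup.zpowers a = ⊤
    · intro u v
      obtain ⟨i, rfl⟩ := Subgroup.mem_zpowers_iff.1 (ha ▸ Subgroup.mem_top u)
      obtain ⟨j, rfl⟩ := Subgroup.mem_zpowers_iff.1 (ha ▸ Subgroup.mem_top v)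
      exact (Commute.zpow_zpow_self a i j).mul_pow p
    -- The maximal subgroup `M` is normal, so it contains `a` and its conjugate; induction in `M`
    -- gives `⁅a, b⁆ ^ p = 1`.
    obtain ⟨M, hM, haM⟩ := (eq_top_or_exists_le_coatom (Subgroup.zpowers a)).resolve_left ha
    have : Group.IsNilpotent L := hL.isNilpotent
    have hMn : M.Normal := Subgroup.NormalizerCondition.normal_of_coatom M
      Group.normalizerCondition_of_isNilpotent hM
    have ham : a ∈ M := haM (Subgroup.mem_zpowers a)
    have hab' : ⁅a, b⁆ = a * (b * a * b⁻¹)⁻¹ := by rw [commutatorElement_def]; group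
    have hexp : ∀ z ∈ commutator L, z ^ p = 1 := by
      refine pow_eq_one_of_mem_commutator hab (M := M) (fun u hu v hv hu1 hv1 => ?_) ?_ ?_
      · simpa [hu1, hv1] using hsub M hM.1 u⁻¹ (inv_mem hu) v hv
      · rw [hab']
        exact mul_mem ham (inv_mem (hMn.conj_mem _ ham b))
      · have := (hsub M hM.1 a⁻¹ (inv_mem ham) _ (inv_mem (hMn.conj_mem _ ham b))).1
          (by rw [inv_pow, inv_pow, hpow])
        rwa [inv_inv, ← hab'] at this
    refine mul_pow_prime_of_lowerCentralSeries_eq_bot hp.out ?_ hexp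
    -- Since `p ≥ 3`, `γ_{p-1}` lies in the derived subgroup, which has exponent `p`; so it is
    -- central and the class is less than `p`.
    have hle : (⊤ : Subgroup L).lowerCentralSeries (p - 2) ≤ Subgroup.center L := fun z hz =>
      hcen z hz (hexp z (Subgroup.lowerCentralSeries_antitone _ (show 1 ≤ p - 2 by omega) hz))
    rw [show p - 1 = p - 2 + 1 by omega, Subgroup.lowerCentralSeries_succ,
      Subgroup.commutator_top_right_eq_bot_iff_le_center]
    exact hle
  by_cases hxy : Subgroup.closure {x, y} = ⊤
  · have hcl : Subgroup.closure {x⁻¹ * y, y} = ⊤ := by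
      rw [← top_le_iff, ← hxy, Subgroup.closure_le]
      have h1 : x⁻¹ * y ∈ Subgroup.closure {x⁻¹ * y, y} := Subgroup.subset_closure (by simp)
      have h2 : y ∈ Subgroup.closure {x⁻¹ * y, y} := Subgroup.subset_closure (by simp)
      rintro z (rfl | rfl)
      · simpa using mul_mem h2 (inv_mem h1)
      · exact h2
    constructor <;> intro h
    · rw [hgen x y hxy (by rw [conj_pow, h, ← pow_succ', pow_succ, mul_inv_cancel_right]), inv_pow, h,
        inv_mul_cancel]
    · have := hgen _ y hcl (by rw [conj_pow, h]; simp) x (x⁻¹ * y)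
      rwa [h, mul_one, mul_inv_cancel_left, eq_comm] at this
  · exact hsub _ hxy x (Subgroup.subset_closure (by simp)) y (Subgroup.subset_closure (by simp))

namespace IsPCentralPair

variable {K : Subgroup L}

theorem normal (h : IsPCentralPair p K) : K.Normal :=
  Subgroup.Normal.of_commutator_le L h.commutator_le

theorem pow_prime_eq_iff [hp : Fact p.Prime] [Finite L] (hL : IsPGroup p L)
    (h : IsPCentralPair p K) {x y : L} (hxy : x⁻¹ * y ∈ K) :
    x ^ p = y ^ p ↔ (x⁻¹ * y) ^ p = 1 := by
  rcases eq_or_ne p 2 with rfl | h2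
  · have hcen : ∀ z ∈ K, z ^ 4 = 1 → z ∈ Subgroup.center L := fun z hz hz4 =>
      h.mem_center z hz (by simp) (by simpa using hz4)
    obtain ⟨c, rfl⟩ : ∃ c, y = x * c := ⟨x⁻¹ * y, by group⟩
    rw [inv_mul_cancel_left] at hxy ⊢
    constructor <;> intro hc
    · have hinv : x⁻¹ * c * x = c⁻¹ := by
        have h1 : x * x = x * c * (x * c) := by simpa [pow_two] using hc
        have h2 : c * x * c = x := by
          apply mul_left_cancel (a := x)
          rw [h1]
          group
        rw [eq_inv_iff_mul_eq_one, mul_assoc, mul_assoc, inv_mul_eq_one, ← mul_assoc, h2]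
      obtain ⟨k, hk⟩ := hL c
      -- Descent on the order of `c`: the power `c ^ 2 ^ k` is central because its fourth power is
      -- trivial, yet `x` inverts it, so its square is already trivial.
      have key : ∀ k, c ^ 2 ^ (k + 1) = 1 → c ^ 2 = 1 := fun k => by
        induction k with
        | zero => simp
        | succ k ih =>
          intro hk
          apply ih
          have hd := hcen (c ^ 2 ^ k) (pow_mem hxy _) (by
            rw [← pow_mul, ← hk]
            ring_nf)
          have h3 : (x⁻¹ * c * x) ^ 2 ^ k = c ^ 2 ^ k := by
            have := conj_pow (i := 2 ^ k) (a := x⁻¹) (b := c)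
            rw [inv_inv] at this
            rw [this, mul_assoc, ← Subgroup.mem_center_iff.1 hd x, inv_mul_cancel_left]
          rw [hinv, inv_pow, inv_eq_iff_mul_eq_one, ← pow_add] at h3
          rw [← h3]
          ring_nf
      rcases k with _ | k
      · simp_all
      · exact key k hk
    · have hx := Subgroup.mem_center_iff.1 (hcen c hxy (by
        rw [show 4 = 2 * 2 from rfl, pow_mul, hc, one_pow])) x
      rw [(show Commute x c from hx).mul_pow, hc, mul_one]
  · refine pow_prime_eq_iff_of_odd h2 hL (fun z hz hzp => h.mem_center z ?_ hz (by simpa [h2])) x y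
    refine h.commutator_le (Subgroup.lowerCentralSeries_antitone _ (show 1 ≤ p - 2 from ?_) hz)
    have := hp.out.two_le
    omega

/-- The elements of `K` of order dividing `p`. -/
def omega [Fact p.Prime] [Finite L] (hL : IsPGroup p L) (h : IsPCentralPair p K) :
    Subgroup L where
  carrier := {z | z ∈ K ∧ z ^ p = 1}
  one_mem' := ⟨one_mem _, one_pow _⟩
  mul_mem' := fun {a b} ha hb => ⟨mul_mem ha.1 hb.1, by
    have := h.pow_prime_eq_iff hL (x := a⁻¹) (y := b) (by simpa using mul_mem ha.1 hb.1)
    simpa [ha.2, hb.2] using this⟩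
  inv_mem' := fun hu => ⟨inv_mem hu.1, by rw [inv_pow, hu.2, inv_one]⟩

theorem mem_omega [Fact p.Prime] [Finite L] {hL : IsPGroup p L} {h : IsPCentralPair p K} {z : L} :
    z ∈ h.omega hL ↔ z ∈ K ∧ z ^ p = 1 := Iff.rfl

theorem omega_normal [Fact p.Prime] [Finite L] (hL : IsPGroup p L) (h : IsPCentralPair p K) :
    (h.omega hL).Normal :=
  ⟨fun z hz g => ⟨h.normal.conj_mem z hz.1 g, by
    rw [conj_pow, hz.2, mul_one, mul_inv_cancel]⟩⟩

/-- If `w` represents an element to be shown central, then `w ^ p` is central in `L`. So `w` and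
each of its conjugates have the same `p`-th power and differ by an element of `h.omega hL`. -/
theorem quotient [hp : Fact p.Prime] [Finite L] (hL : IsPGroup p L) (h : IsPCentralPair p K)
    [(h.omega hL).Normal] : IsPCentralPair p (K.map (QuotientGroup.mk' (h.omega hL))) where
  commutator_le := by
    rw [← Subgroup.top_lowerCentralSeries_one,
      ← Subgroup.map_top_of_surjective _ (QuotientGroup.mk'_surjective (h.omega hL)),
      ← Subgroup.map_lowerCentralSeries]
    exact Subgroup.map_mono h.commutator_le
  mem_center := by
    intro z hzK hz hzp
    rw [← Subgroup.map_top_of_surjective _ (QuotientGroup.mk'_surjective (h.omega hL)),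
      ← Subgroup.map_lowerCentralSeries] at hz
    obtain ⟨w, hw, rfl⟩ := hz
    have hwK : w ∈ K := by
      obtain ⟨v, hv, hvw⟩ := hzK
      have := (QuotientGroup.eq.1 hvw).1
      simpa using mul_mem hv this
    have hq : (w ^ (if p = 2 then 4 else p)) ^ p = 1 := by
      rw [← map_pow, ← MonoidHom.mem_ker, QuotientGroup.ker_mk'] at hzp
      exact hzp.2
    have hc := h.mem_center (w ^ p) (pow_mem hwK _) (pow_mem hw _) (by
      rwa [← pow_mul, mul_comm, pow_mul])
    rw [Subgroup.mem_center_iff] at hc ⊢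
    intro g
    obtain ⟨g, rfl⟩ := QuotientGroup.mk'_surjective _ g
    have hmem : w⁻¹ * (g * w * g⁻¹) ∈ K := mul_mem (inv_mem hwK) (h.normal.conj_mem w hwK g)
    have := (h.pow_prime_eq_iff hL hmem).1 (by rw [conj_pow, hc g, mul_inv_cancel_right])
    have h1 : QuotientGroup.mk' (h.omega hL) (w⁻¹ * (g * w * g⁻¹)) = 1 :=
      (QuotientGroup.eq_one_iff _).2 ⟨hmem, this⟩
    simp only [map_mul, map_inv] at h1
    rw [inv_mul_eq_one, eq_mul_inv_iff_mul_eq] at h1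
    exact h1.symm

/-- For a `p`-central pair `(L, K)` of finite `p`-groups, elements of the same coset of `K` have the
same `p ^ i`-th power if and only if their quotient has order dividing `p ^ i`. -/
theorem pow_prime_pow_eq_iff [Fact p.Prime] [Finite L] (hL : IsPGroup p L)
    (h : IsPCentralPair p K) (i : ℕ) {x y : L} (hxy : x⁻¹ * y ∈ K) :
    x ^ p ^ i = y ^ p ^ i ↔ (x⁻¹ * y) ^ p ^ i = 1 := by
  induction i generalizing L with
  | zero => simp [inv_mul_eq_one]
  | succ i ih =>
    have := h.omega_normal hL
    have := h.normal
    have hmem : (x ^ p ^ i)⁻¹ * y ^ p ^ i ∈ K := by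
      rw [← QuotientGroup.eq] at hxy ⊢
      simp [hxy]
    have := ih (hL.to_quotient (h.omega hL)) (h.quotient hL)
      (x := QuotientGroup.mk' _ x) (y := QuotientGroup.mk' _ y)
      (by rw [← map_inv, ← map_mul]; exact ⟨_, hxy, rfl⟩)
    rw [← map_inv, ← map_mul, ← map_pow, ← map_pow, ← map_pow, ← inv_mul_eq_one, ← map_inv,
      ← map_mul] at this
    simp only [← MonoidHom.mem_ker, QuotientGroup.ker_mk', mem_omega, hmem, pow_mem hxy,
      true_and] at this
    rw [pow_succ, pow_mul, pow_mul, pow_mul, h.pow_prime_eq_iff hL hmem, this]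

end IsPCentralPair

end PowerInjectivity

/-! ### The series of action commutators in an ambient group -/

namespace Subgroup

variable {P : Type*} [Group P]

theorem commutator_le_iff_le_comap_centralizer {H K N : Subgroup P} [N.Normal] :
    ⁅H, K⁆ ≤ N ↔ H ≤ (centralizer (K.map (QuotientGroup.mk' N) : Set (P ⧸ N))).comap
      (QuotientGroup.mk' N) := by
  rw [← map_le_iff_le_comap, ← commutator_eq_bot_iff_le_centralizer, ← map_commutator,
    map_eq_bot_iff, QuotientGroup.ker_mk']

theorem sup_commutator_le {H₁ H₂ K N : Subgroup P} [N.Normal] (h1 : ⁅H₁, K⁆ ≤ N)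
    (h2 : ⁅H₂, K⁆ ≤ N) : ⁅H₁ ⊔ H₂, K⁆ ≤ N := by
  rw [commutator_le_iff_le_comap_centralizer] at *
  exact sup_le h1 h2

theorem normalClosure_commutator_le {H K N : Subgroup P} [K.Normal] [N.Normal]
    (h : ⁅H, K⁆ ≤ N) : ⁅normalClosure (H : Set P), K⁆ ≤ N := by
  rw [commutator_le_iff_le_comap_centralizer] at *
  have : (K.map (QuotientGroup.mk' N)).Normal :=
    Normal.map inferInstance _ (QuotientGroup.mk'_surjective N)
  exact normalClosure_le_normal h

/-- The series `G`, `[G, A]`, `[G, A, A]`, …, where at each step one takes the normal closure. -/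
def actionSeries (G A : Subgroup P) : ℕ → Subgroup P
  | 0 => G
  | k + 1 => normalClosure (⁅actionSeries G A k, A⁆ : Subgroup P)

variable (G A : Subgroup P)

theorem commutator_actionSeries_le_succ (k : ℕ) :
    ⁅actionSeries G A k, A⁆ ≤ actionSeries G A (k + 1) :=
  subset_normalClosure

/-- Three subgroups lemma: `⁅N, A⁆` is trivial and `⁅N, G⁆ ≤ N`. -/
theorem le_centralizer_actionSeries_one {N : Subgroup P} [N.Normal]
    (h : N ≤ centralizer (A : Set P)) : N ≤ centralizer (actionSeries G A 1 : Set P) := by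
  rw [← commutator_eq_bot_iff_le_centralizer] at h ⊢
  rw [commutator_comm, ← le_bot_iff]
  refine normalClosure_commutator_le (commutator_commutator_le_of_rotate ?_ ?_)
  · rw [commutator_comm A, h, commutator_bot_left]
  · exact (commutator_mono (commutator_le_left N _) le_rfl).trans h.le

variable [G.Normal]

instance actionSeries_normal (k : ℕ) : (actionSeries G A k).Normal := by
  cases k
  · assumption
  · exact normalClosure_normal

theorem actionSeries_antitone : Antitone (actionSeries G A) :=
  antitone_nat_of_succ_le fun _ => normalClosure_le_normal (commutator_le_left _ _)

theorem actionSeries_le (k : ℕ) : actionSeries G A k ≤ G :=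
  actionSeries_antitone G A (Nat.zero_le k)

theorem commutator_actionSeries_le (i j : ℕ) :
    ⁅actionSeries G A i, actionSeries G A j⁆ ≤ actionSeries G A (i + j) := by
  induction j generalizing i with
  | zero => exact commutator_le_left _ _
  | succ j ih =>
    rw [commutator_comm]
    refine normalClosure_commutator_le (commutator_commutator_le_of_rotate ?_ ?_)
    · rw [commutator_comm A, ← add_assoc, add_right_comm]
      exact (commutator_mono (commutator_actionSeries_le_succ G A i) le_rfl).trans (ih (i + 1))
    · exact (commutator_mono (ih i) le_rfl).trans (commutator_actionSeries_le_succ G A _)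

theorem commutator_actionSeries_lowerCentralSeries_le (i k : ℕ) :
    ⁅actionSeries G A i, A.lowerCentralSeries k⁆ ≤ actionSeries G A (i + k + 1) := by
  induction k generalizing i with
  | zero => exact commutator_actionSeries_le_succ G A i
  | succ k ih =>
    rw [commutator_comm, lowerCentralSeries_succ]
    refine commutator_commutator_le_of_rotate ?_ ?_
    · rw [commutator_comm A, ← add_assoc, add_right_comm i k 1]
      exact (commutator_mono (commutator_actionSeries_le_succ G A i) le_rfl).trans (ih (i + 1))
    · exact (commutator_mono (ih i) le_rfl).trans (commutator_actionSeries_le_succ G A _)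

/-- Because `zpowers a` is abelian, the derived subgroup already lies in term 2; each further
commutation moves one term down. -/
theorem lowerCentralSeries_zpowers_sup_le {a : P} (ha : a ∈ A) (k : ℕ) :
    (zpowers a ⊔ actionSeries G A 1).lowerCentralSeries (k + 1) ≤ actionSeries G A (k + 2) := by
  have hZ : zpowers a ≤ A := by rwa [zpowers_le]
  have hcomm : ∀ i, ⁅actionSeries G A i, zpowers a ⊔ actionSeries G A 1⁆ ≤
      actionSeries G A (i + 1) := fun i => by
    rw [commutator_comm]
    refine sup_commutator_le ?_ ?_ <;> rw [commutator_comm]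
    · exact (commutator_mono le_rfl hZ).trans (commutator_actionSeries_le_succ G A i)
    · exact commutator_actionSeries_le G A i 1
  induction k with
  | zero =>
    refine sup_commutator_le ?_ (hcomm 1)
    rw [commutator_comm]
    refine sup_commutator_le ?_ ?_
    · rw [commutator_self_eq_bot_iff.2 inferInstance]
      exact bot_le
    · exact (commutator_mono le_rfl hZ).trans (commutator_actionSeries_le_succ G A 1)
  | succ k ih =>
    rw [lowerCentralSeries_succ]
    exact (commutator_mono ih le_rfl).trans (hcomm (k + 2))

end Subgroup

/-! ### `p`-central actions inside an ambient group -/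

section PCentralAction

open Subgroup

/-- The elements of order dividing `p` (dividing `4` if `p = 2`) of the term with index `p - 1` of
`actionSeries G A` commute with `A`. -/
def IsPCentralAction (p : ℕ) {P : Type*} [Group P] (G A : Subgroup P) : Prop :=
  ∀ z ∈ actionSeries G A (p - 1), z ^ (if p = 2 then 4 else p) = 1 → ∀ a ∈ A, Commute a z

namespace IsPCentralAction

variable {p : ℕ} {P : Type*} [Group P] {G A : Subgroup P} [G.Normal]

theorem commute_actionSeries_one (h : IsPCentralAction p G A) {z : P}
    (hz : z ∈ actionSeries G A (p - 1)) (hzp : z ^ (if p = 2 then 4 else p) = 1) {x : P}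
    (hx : x ∈ actionSeries G A 1) : Commute x z := by
  let S : Set P := {z | z ∈ actionSeries G A (p - 1) ∧ z ^ (if p = 2 then 4 else p) = 1}
  have hS : normalClosure S ≤ centralizer (A : Set P) := by
    refine (closure_le _).2 fun w hw a ha => ?_
    obtain ⟨z, ⟨hz, hzp⟩, hzw⟩ := Group.mem_conjugatesOfSet_iff.1 hw
    obtain ⟨g, rfl⟩ := isConj_iff.1 hzw
    exact h _ (Normal.conj_mem inferInstance z hz g) (by rw [conj_pow, hzp]; simp) a ha
  have := le_centralizer_actionSeries_one G A hS
    (subset_normalClosure (show z ∈ S from ⟨hz, hzp⟩))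
  exact this x hx

/-- Climbing the series from its trivial term, `⁅a, x⁆` commutes with `a`. Raising `x * a⁻¹ * x⁻¹ =
a⁻¹ * ⁅a, x⁆` to the order of `a` makes the order of `⁅a, x⁆` both prime to `p` and a power of `p`.
-/
theorem commute_of_coprime (hG : IsPGroup p G) {m : ℕ} (hm : actionSeries G A m = ⊥) {a : P}
    (ha : a ∈ A) (hap : (orderOf a).Coprime p) {g : P} (hg : g ∈ G) : Commute a g := by
  suffices H : ∀ j ≤ m, ∀ x ∈ actionSeries G A (m - j), Commute a x from
    H m le_rfl g (by rwa [Nat.sub_self])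
  intro j
  induction j with
  | zero =>
    intro _ x hx
    rw [Nat.sub_zero, hm, mem_bot] at hx
    rw [hx]
    exact Commute.one_right a
  | succ j ih =>
    intro hj x hx
    have hc : ⁅a, x⁆ ∈ actionSeries G A (m - j) := by
      rw [show m - j = m - (j + 1) + 1 by omega]
      refine commutator_actionSeries_le_succ G A _ ?_
      rw [commutator_comm]
      exact commutator_mem_commutator ha hx
    have hcomm := ih (by omega) _ hc
    have h1 : x * a⁻¹ * x⁻¹ = a⁻¹ * ⁅a, x⁆ := by rw [commutatorElement_def]; group
    have h2 := congrArg (· ^ orderOf a) h1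
    simp only [conj_pow, hcomm.inv_left.mul_pow, inv_pow, pow_orderOf_eq_one] at h2
    obtain ⟨k, hk⟩ := hG ⟨⁅a, x⁆, actionSeries_le G A _ hc⟩
    have hk' : ⁅a, x⁆ ^ p ^ k = 1 := by simpa [Subtype.ext_iff] using hk
    have h3 : ⁅a, x⁆ = 1 := by
      have := (pow_gcd_eq_one (a := ⁅a, x⁆) (m := orderOf a) (n := p ^ k)).2
        ⟨by simpa using h2.symm, hk'⟩
      rwa [(hap.pow_right k).gcd_eq_one, pow_one] at this
    exact commutatorElement_eq_one_iff_commute.1 h3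

variable [hp : Fact p.Prime]

theorem isPCentralPair (h : IsPCentralAction p G A) {a : P} (ha : a ∈ A) :
    IsPCentralPair p ((actionSeries G A 1).subgroupOf (zpowers a ⊔ actionSeries G A 1)) := by
  have hmap : ∀ k, ∀ z ∈ (⊤ : Subgroup ↥(zpowers a ⊔ actionSeries G A 1)).lowerCentralSeries k,
      (z : P) ∈ (zpowers a ⊔ actionSeries G A 1).lowerCentralSeries k := fun k z hz => by
    rw [← top_subtype_lowerCentralSeries]
    exact ⟨z, hz, rfl⟩
  refine ⟨fun z hz => ?_, fun z hz1 hz hzp => ?_⟩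
  · exact actionSeries_antitone G A one_le_two (lowerCentralSeries_zpowers_sup_le G A ha 0
      (hmap 1 z hz))
  · have hzN : (z : P) ∈ actionSeries G A (p - 1) := by
      -- For `p = 2` the lower central condition is vacuous, and membership in `[G, A]`, the term
      -- with index `p - 1 = 1`, is what serves.
      rcases eq_or_ne p 2 with rfl | h2
      · exact hz1
      · have := hp.out.two_le
        obtain ⟨k, rfl⟩ : ∃ k, p = k + 3 := ⟨p - 3, by omega⟩
        exact lowerCentralSeries_zpowers_sup_le G A ha k (hmap _ z hz)
    have hzp' : (z : P) ^ (if p = 2 then 4 else p) = 1 := by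
      rw [← coe_pow, hzp, coe_one]
    have hT : zpowers a ⊔ actionSeries G A 1 ≤ centralizer {(z : P)} := by
      refine sup_le ?_ fun x hx => ?_
      · rw [zpowers_le, mem_centralizer_singleton_iff]
        exact h z hzN hzp' a ha
      · rw [mem_centralizer_singleton_iff]
        exact h.commute_actionSeries_one hzN hzp' hx
    rw [mem_center_iff]
    exact fun g => Subtype.ext (mem_centralizer_singleton_iff.1 (hT g.2))

theorem pow_prime_pow_eq_iff [Finite P] (hG : IsPGroup p G) (h : IsPCentralAction p G A) {a : P}
    (ha : a ∈ A) (hap : IsPGroup p (zpowers a)) (i : ℕ) {x y : P}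
    (hx : x ∈ zpowers a ⊔ actionSeries G A 1) (hxy : x⁻¹ * y ∈ actionSeries G A 1) :
    x ^ p ^ i = y ^ p ^ i ↔ (x⁻¹ * y) ^ p ^ i = 1 := by
  have hy : y ∈ zpowers a ⊔ actionSeries G A 1 := by
    simpa using mul_mem hx (le_sup_right (a := zpowers a) hxy)
  have hT : IsPGroup p ↥(zpowers a ⊔ actionSeries G A 1) :=
    hap.to_sup_of_normal_right (hG.to_le (actionSeries_le G A 1))
  have := (h.isPCentralPair ha).pow_prime_pow_eq_iff hT i (x := ⟨x, hx⟩) (y := ⟨y, hy⟩)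
    (by simpa [mem_subgroupOf] using hxy)
  simpa [Subtype.ext_iff] using this

theorem pow_prime_pow_eq_iff_of_mem [Finite P] (hG : IsPGroup p G) (h : IsPCentralAction p G A)
    (i : ℕ) {x y : P} (hx : x ∈ actionSeries G A 1) (hy : y ∈ actionSeries G A 1) :
    x ^ p ^ i = y ^ p ^ i ↔ (x⁻¹ * y) ^ p ^ i = 1 :=
  h.pow_prime_pow_eq_iff hG (one_mem A) (by rw [zpowers_one_eq_bot]; exact .of_bot) i
    (le_sup_right (a := zpowers (1 : P)) hx) (mul_mem (inv_mem hx) hy)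

/-- The elements of `[G, A]` of order dividing `p ^ i`. -/
def omega [Finite P] (hG : IsPGroup p G) (h : IsPCentralAction p G A) (i : ℕ) : Subgroup P where
  carrier := {z | z ∈ actionSeries G A 1 ∧ z ^ p ^ i = 1}
  one_mem' := ⟨one_mem _, one_pow _⟩
  mul_mem' := fun {a b} ha hb => ⟨mul_mem ha.1 hb.1, by
    have := h.pow_prime_pow_eq_iff_of_mem hG i (inv_mem ha.1) hb.1
    simpa [ha.2, hb.2] using this⟩
  inv_mem' := fun hu => ⟨inv_mem hu.1, by rw [inv_pow, hu.2, inv_one]⟩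

variable [Finite P]

theorem mem_omega {hG : IsPGroup p G} {h : IsPCentralAction p G A} {i : ℕ} {z : P} :
    z ∈ h.omega hG i ↔ z ∈ actionSeries G A 1 ∧ z ^ p ^ i = 1 := Iff.rfl

instance omega_normal (hG : IsPGroup p G) (h : IsPCentralAction p G A) (i : ℕ) :
    (h.omega hG i).Normal :=
  ⟨fun z hz g => ⟨Normal.conj_mem inferInstance z hz.1 g, by
    rw [conj_pow, hz.2, mul_one, mul_inv_cancel]⟩⟩

/-- If `x ^ p ^ (m + 1) = 1`, then `x⁻¹ ^ p ^ m` has order dividing `p` and commutes with `a`. So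
`x⁻¹` and its conjugate by `a` have equal `p ^ m`-th powers, whence `⁅x, a⁆ ^ p ^ m = 1`. -/
theorem actionSeries_le_omega (hG : IsPGroup p G) (h : IsPCentralAction p G A) {n : ℕ}
    (hn : ∀ z ∈ actionSeries G A 1, z ^ p ^ n = 1) (j m : ℕ)
    (hjm : j + m = n) : actionSeries G A (p - 1 + j) ≤ h.omega hG m := by
  have hp2 := hp.out.two_le
  induction j generalizing m with
  | zero =>
    obtain rfl : m = n := by omega
    intro z hz
    have hz1 := actionSeries_antitone G A (show 1 ≤ p - 1 by omega) hz
    exact ⟨hz1, hn z hz1⟩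
  | succ j ih =>
    refine normalClosure_le_normal (commutator_le.2 fun x hx a ha => ?_)
    have hxp := ih (m + 1) (by omega) hx
    have heq : ⁅x, a⁆ = x⁻¹⁻¹ * (a * x⁻¹ * a⁻¹) := by rw [commutatorElement_def]; group
    refine ⟨by
      rw [heq]
      exact mul_mem (inv_mem (inv_mem hxp.1)) (Normal.conj_mem inferInstance _ (inv_mem hxp.1) a),
      ?_⟩
    rw [heq, ← h.pow_prime_pow_eq_iff_of_mem hG m (inv_mem hxp.1)
      (Normal.conj_mem inferInstance _ (inv_mem hxp.1) a), conj_pow]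
    have hc := h (x⁻¹ ^ p ^ m)
      (pow_mem (inv_mem (actionSeries_antitone G A (Nat.le_add_right _ j) hx)) _) (by
        have h1 : (x⁻¹ ^ p ^ m) ^ p = 1 := by
          rw [← pow_mul, ← pow_succ, inv_pow, hxp.2, inv_one]
        split_ifs with h2
        · subst h2
          rw [show 4 = 2 * 2 from rfl, pow_mul, h1, one_pow]
        · exact h1) a ha
    rw [hc.eq, mul_inv_cancel_right]

theorem actionSeries_eq_bot (hG : IsPGroup p G) (h : IsPCentralAction p G A) {n : ℕ}
    (hn : ∀ z ∈ actionSeries G A 1, z ^ p ^ n = 1) :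
    actionSeries G A (p - 1 + n) = ⊥ := by
  rw [eq_bot_iff]
  intro z hz
  simpa using (h.actionSeries_le_omega hG hn n 0 (add_zero n) hz).2

theorem isPGroup (hG : IsPGroup p G) (h : IsPCentralAction p G A)
    (hfaith : ∀ a ∈ A, (∀ g ∈ G, Commute a g) → a = 1) : IsPGroup p A := by
  obtain ⟨n, hn⟩ := hG.exists_card_eq
  have hbot := h.actionSeries_eq_bot hG (n := n) fun z hz => by
    have := pow_card_eq_one' (x := (⟨z, actionSeries_le G A 1 hz⟩ : G))
    rw [hn] at this
    simpa [Subtype.ext_iff] using this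
  rintro ⟨a, ha⟩
  obtain ⟨k, m, hm, hk⟩ := Nat.exists_eq_pow_mul_and_not_dvd (orderOf_pos a).ne' p hp.out.ne_one
  refine ⟨k, Subtype.ext (hfaith _ (pow_mem ha _) fun g hg =>
    commute_of_coprime hG hbot (pow_mem ha _) ?_ hg)⟩
  rw [orderOf_pow, hk, Nat.gcd_mul_right_left, Nat.mul_div_cancel_left _ (pow_pos hp.out.pos k)]
  exact ((Nat.Prime.coprime_iff_not_dvd hp.out).2 hm).symm

/-- The link between orders in `A` and in `[G, A]`: compare the `p ^ i`-th powers of `a⁻¹` and `g *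
a⁻¹ * g⁻¹`, whose quotient is `⁅a, g⁆`. -/
theorem commute_pow_iff (hG : IsPGroup p G) (h : IsPCentralAction p G A) {a : P}
    (ha : a ∈ A) (hap : IsPGroup p (zpowers a)) (i : ℕ) {g : P} (hg : g ∈ G) :
    Commute (a ^ p ^ i) g ↔ ⁅a, g⁆ ∈ h.omega hG i := by
  have hc : ⁅a, g⁆ ∈ actionSeries G A 1 := by
    refine commutator_actionSeries_le_succ G A 0 ?_
    rw [commutator_comm]
    exact commutator_mem_commutator ha hg
  have heq : ⁅a, g⁆ = a⁻¹⁻¹ * (g * a⁻¹ * g⁻¹) := by rw [commutatorElement_def]; group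
  have := h.pow_prime_pow_eq_iff hG ha hap i (x := a⁻¹) (y := g * a⁻¹ * g⁻¹)
    (inv_mem (le_sup_left (b := actionSeries G A 1) (mem_zpowers a))) (heq ▸ hc)
  rw [mem_omega, and_iff_right hc, heq, ← this, conj_pow, eq_mul_inv_iff_mul_eq, inv_pow]
  exact Commute.inv_left_iff.symm

end IsPCentralAction

end PCentralAction

/-! ### Normality and invariance of `γ_k(G, A)` and `[G, A]` -/

section ActionCommutators

variable {G : Type*} [Group G] {A : Type*} [Group A] [MulDistribMulAction A G]

theorem IsLeftNormedCommutator.mem_gammaAction {j k : ℕ} {c : G}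
    (h : IsLeftNormedCommutator A j c) (hk : k ≤ j + 1) : c ∈ gammaAction k G A :=
  Subgroup.subset_closure ⟨j, hk, h⟩

theorem inv_mul_smul_mem_commutatorAction (x : G) (a : A) :
    x⁻¹ * a • x ∈ commutatorAction G A :=
  Subgroup.subset_closure ⟨x, a, rfl⟩

instance gammaAction_normal (k : ℕ) : (gammaAction k G A).Normal := by
  refine ⟨fun x hx g => ?_⟩
  induction hx using Subgroup.closure_induction with
  | mem c hc =>
    obtain ⟨j, hj, h⟩ := hc
    have h1 := mul_mem (h.mem_gammaAction hj) ((h.commGroup g⁻¹).mem_gammaAction hj)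
    simpa using h1
  | one => simp
  | mul x y _ _ h1 h2 => simpa using mul_mem h1 h2
  | inv x _ h => simpa [mul_assoc] using inv_mem h

theorem smul_mem_gammaAction {k : ℕ} {x : G} (hx : x ∈ gammaAction k G A) (a : A) :
    a • x ∈ gammaAction k G A := by
  induction hx using Subgroup.closure_induction with
  | mem c hc =>
    obtain ⟨j, hj, h⟩ := hc
    have h1 := mul_mem (h.mem_gammaAction hj)
      ((h.commAction a).mem_gammaAction (k := k) (by omega))
    simpa using h1
  | one => simp
  | mul x y _ _ h1 h2 => simpa using mul_mem h1 h2
  | inv x _ h => simpa using inv_mem h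

theorem inv_mul_smul_mem_gammaAction {k : ℕ} {x : G} (hx : x ∈ gammaAction k G A) (a : A) :
    x⁻¹ * a • x ∈ gammaAction (k + 1) G A := by
  induction hx using Subgroup.closure_induction with
  | mem c hc =>
    obtain ⟨j, hj, h⟩ := hc
    exact (h.commAction a).mem_gammaAction (by omega)
  | one => simp
  | mul x y _ _ h1 h2 =>
    have := mul_mem ((gammaAction_normal (k + 1)).conj_mem _ h1 y⁻¹) h2
    simpa [mul_assoc] using this
  | inv x _ h =>
    have := (gammaAction_normal (k + 1)).conj_mem _ (inv_mem h) x
    simpa [mul_assoc] using this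

instance commutatorAction_normal : (commutatorAction G A).Normal := by
  refine ⟨fun x hx g => ?_⟩
  induction hx using Subgroup.closure_induction with
  | mem c hc =>
    obtain ⟨x, a, rfl⟩ := hc
    have h1 := mul_mem (inv_mul_smul_mem_commutatorAction (x * g⁻¹) a)
      (inv_mem (inv_mul_smul_mem_commutatorAction g⁻¹ a))
    simpa [mul_assoc] using h1
  | one => simp
  | mul x y _ _ h1 h2 => simpa using mul_mem h1 h2
  | inv x _ h => simpa [mul_assoc] using inv_mem h

theorem smul_mem_commutatorAction {x : G} (hx : x ∈ commutatorAction G A) (a : A) :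
    a • x ∈ commutatorAction G A := by
  simpa using mul_mem hx (inv_mul_smul_mem_commutatorAction x a)

end ActionCommutators

/-! ### Translation to the semidirect product -/

section Semidirect

open SemidirectProduct Subgroup

variable {G : Type*} [Group G] {A : Type*} [Group A] [MulDistribMulAction A G]

local notation "Hol" => G ⋊[MulDistribMulAction.toMulAut A G] A

theorem inl_smul (a : A) (g : G) :
    (inl (a • g) : Hol) = inr a * inl g * (inr a)⁻¹ := by
  rw [← map_inv, ← inl_aut]
  rfl

theorem commutatorElement_inl_inr (g : G) (a : A) :
    ⁅(inl g : Hol), (inr a : Hol)⁆ = inl (g⁻¹⁻¹ * a • g⁻¹) := by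
  rw [map_mul, inl_smul, commutatorElement_def]
  simp [mul_assoc]

theorem normal_map_inl {N : Subgroup G} [hN : N.Normal] (h : ∀ x ∈ N, ∀ a : A, a • x ∈ N) :
    (N.map (inl : G →* Hol)).Normal := by
  refine ⟨?_⟩
  rintro _ ⟨x, hx, rfl⟩ y
  rw [← inl_left_mul_inr_right y]
  refine ⟨y.left * (y.right • x) * y.left⁻¹, hN.conj_mem _ (h x hx _) _, ?_⟩
  rw [map_mul, map_mul, inl_smul, map_inv]
  group

instance normal_range_inl : (inl : G →* Hol).range.Normal := by
  rw [range_inl_eq_ker_rightHom]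
  infer_instance

/-- Indices shift by one. An inclusion suffices, since it only serves to transfer the `p`-centrality
hypothesis to a smaller subgroup. -/
theorem actionSeries_le_map_gammaAction (k : ℕ) :
    actionSeries (inl : G →* Hol).range inr.range k ≤
      (gammaAction (k + 1) G A).map (inl : G →* Hol) := by
  induction k with
  | zero =>
    rintro _ ⟨g, rfl⟩
    exact ⟨g, subset_closure ⟨0, le_rfl, .base g⟩, rfl⟩
  | succ k ih =>
    have := normal_map_inl (A := A) (N := gammaAction (k + 2) G A)
      fun x hx a => smul_mem_gammaAction hx a
    refine normalClosure_le_normal (commutator_le.2 fun x hx y hy => ?_)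
    obtain ⟨g, hg, rfl⟩ := ih hx
    obtain ⟨a, rfl⟩ := hy
    rw [commutatorElement_inl_inr]
    exact ⟨_, inv_mul_smul_mem_gammaAction (inv_mem hg) a, rfl⟩

theorem actionSeries_one_eq_map_commutatorAction :
    actionSeries (inl : G →* Hol).range inr.range 1 =
      (commutatorAction G A).map (inl : G →* Hol) := by
  apply le_antisymm
  · have := normal_map_inl (A := A) (N := commutatorAction G A)
      fun x hx a => smul_mem_commutatorAction hx a
    refine normalClosure_le_normal (commutator_le.2 ?_)
    rintro _ ⟨g, rfl⟩ _ ⟨a, rfl⟩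
    rw [commutatorElement_inl_inr]
    exact ⟨_, inv_mul_smul_mem_commutatorAction g⁻¹ a, rfl⟩
  · rw [map_le_iff_le_comap, commutatorAction, closure_le]
    rintro _ ⟨g, a, rfl⟩
    have := commutator_actionSeries_le_succ (inl : G →* Hol).range inr.range 0
      (commutator_mem_commutator (g₁ := inl g⁻¹) (g₂ := inr a) ⟨_, rfl⟩ ⟨_, rfl⟩)
    rw [commutatorElement_inl_inr] at this
    simpa using this

theorem ActsPCentrallyOn.isPCentralAction {p : ℕ} [hp : Fact p.Prime]
    (h : ActsPCentrallyOn p A (gammaAction p G A)) :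
    IsPCentralAction p (inl : G →* Hol).range inr.range := by
  rintro z hz hzp _ ⟨a, rfl⟩
  obtain ⟨g, hg, rfl⟩ := actionSeries_le_map_gammaAction _ hz
  rw [Nat.sub_add_cancel hp.out.one_le] at hg
  rw [← map_pow, ← map_one (inl : G →* Hol), inl_inj] at hzp
  have := inl_smul (G := G) a g
  rw [h g hg (orderOf_dvd_of_pow_eq_one hzp) a, eq_mul_inv_iff_mul_eq] at this
  exact this.symm

theorem commute_inr_inl_iff {a : A} {g : G} : Commute (inr a : Hol) (inl g) ↔ a • g = g := by
  rw [← inl_inj (φ := MulDistribMulAction.toMulAut A G), inl_smul, mul_inv_eq_iff_eq_mul]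
  rfl

end Semidirect

/-! ### Consequences for faithful `p`-central actions -/

section PCentralAutomorphisms

open SemidirectProduct Subgroup

variable {p : ℕ} [hp : Fact p.Prime] {G : Type*} [Group G] [Finite G] {A : Type*} [Group A]
  [Finite A] [MulDistribMulAction A G]

local notation "Hol" => G ⋊[MulDistribMulAction.toMulAut A G] A

instance : Finite Hol := Finite.of_equiv _ equivProd.symm

/-- The elements of `[G, A]` of order dividing `p ^ i`, when `A` acts `p`-centrally on
`γ_p(G, A)`. -/
theorem exists_subgroup_pow_eq_one (hG : IsPGroup p G)
    (h : ActsPCentrallyOn p A (gammaAction p G A)) (i : ℕ) :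
    ∃ K : Subgroup G, (∀ x, x ∈ K ↔ x ∈ commutatorAction G A ∧ x ^ p ^ i = 1) ∧
      ∀ x ∈ K, ∀ a : A, a • x ∈ K := by
  have hr := hG.of_surjective _ (inl : G →* Hol).rangeRestrict_surjective
  refine ⟨(h.isPCentralAction.omega hr i).comap inl, fun x => ?_, fun x hx a => ?_⟩
  · rw [mem_comap, IsPCentralAction.mem_omega, actionSeries_one_eq_map_commutatorAction,
      ← map_pow, ← map_one (inl : G →* Hol), inl_inj, mem_map_iff_mem inl_injective]
  · rw [mem_comap, inl_smul]
    exact (h.isPCentralAction.omega_normal hr i).conj_mem _ hx _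

theorem isPGroup_of_actsPCentrallyOn [FaithfulSMul A G] (hG : IsPGroup p G)
    (h : ActsPCentrallyOn p A (gammaAction p G A)) : IsPGroup p A := by
  have hr := hG.of_surjective _ (inl : G →* Hol).rangeRestrict_surjective
  have := h.isPCentralAction.isPGroup hr (by
    rintro _ ⟨a, rfl⟩ ha
    rw [show a = 1 from eq_of_smul_eq_smul (α := G) fun g => by
      rw [one_smul]
      exact commute_inr_inl_iff.1 (ha _ ⟨g, rfl⟩), map_one])
  exact this.of_injective (inr : A →* Hol).rangeRestrict
    ((MonoidHom.rangeRestrict_injective_iff).2 inr_injective)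

theorem pow_eq_one_iff_forall_smul [FaithfulSMul A G] (hG : IsPGroup p G)
    (h : ActsPCentrallyOn p A (gammaAction p G A)) (i : ℕ) (a : A) :
    a ^ p ^ i = 1 ↔ ∀ g : G, (g⁻¹ * a • g) ^ p ^ i = 1 := by
  have hr := hG.of_surjective _ (inl : G →* Hol).rangeRestrict_surjective
  have ha : IsPGroup p (zpowers (inr a : Hol)) := by
    rw [← MonoidHom.map_zpowers]
    exact ((isPGroup_of_actsPCentrallyOn hG h).to_subgroup _).map inr
  have key : ∀ g : G, (a ^ p ^ i) • g = g ↔ (g * a • g⁻¹) ^ p ^ i = 1 := fun g => by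
    have h1 := h.isPCentralAction.commute_pow_iff hr ⟨a, rfl⟩ ha i (g := inl g) ⟨g, rfl⟩
    rw [← map_pow, commute_inr_inl_iff, ← inv_mem_iff, commutatorElement_inv,
      commutatorElement_inl_inr, IsPCentralAction.mem_omega,
      actionSeries_one_eq_map_commutatorAction, mem_map_iff_mem inl_injective,
      and_iff_right (inv_mul_smul_mem_commutatorAction _ _), ← map_pow,
      ← map_one (inl : G →* Hol), inl_inj, inv_inv] at h1
    exact h1
  constructor
  · intro h1 g
    simpa using (key g⁻¹).1 (by rw [h1, one_smul])
  · intro h1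
    refine eq_of_smul_eq_smul (α := G) fun g => ?_
    rw [one_smul, key]
    simpa using h1 g⁻¹

/-- Term `n + p - 1` of the action series is trivial. It contains `[G, γ_{n+p-1}(A)]`, which
vanishes only if `γ_{n+p-1}(A)` does, by faithfulness; it also contains `γ_{n+p-1}([G, A])`. -/
theorem lowerCentralSeries_eq_bot_of_actsPCentrallyOn [FaithfulSMul A G] (hG : IsPGroup p G)
    (h : ActsPCentrallyOn p A (gammaAction p G A)) {n : ℕ}
    (hn : ∀ x ∈ commutatorAction G A, x ^ p ^ n = 1) :
    (⊤ : Subgroup A).lowerCentralSeries (n + p - 2) = ⊥ ∧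
      (⊤ : Subgroup (commutatorAction G A)).lowerCentralSeries (n + p - 2) = ⊥ := by
  have hr := hG.of_surjective _ (inl : G →* Hol).rangeRestrict_surjective
  have hbot := h.isPCentralAction.actionSeries_eq_bot hr (n := n) (by
    rw [actionSeries_one_eq_map_commutatorAction]
    rintro _ ⟨x, hx, rfl⟩
    rw [← map_pow, hn x hx, map_one])
  have hp2 := hp.out.two_le
  rw [show p - 1 + n = n + p - 2 + 1 by omega] at hbot
  constructor
  · rw [eq_bot_iff]
    intro a ha
    refine eq_of_smul_eq_smul (α := G) fun g => ?_
    rw [one_smul, ← commute_inr_inl_iff, ← commutatorElement_eq_one_iff_commute,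
      ← commutatorElement_inv, inv_eq_one, ← mem_bot, ← hbot]
    have h1 := commutator_actionSeries_lowerCentralSeries_le (inl : G →* Hol).range inr.range 0
      (n + p - 2)
    rw [zero_add] at h1
    refine h1 (commutator_mem_commutator ⟨g, rfl⟩ ?_)
    rw [MonoidHom.range_eq_map, ← map_lowerCentralSeries]
    exact ⟨a, ha, rfl⟩
  · set N := (commutatorAction G A)
    have hle : ∀ k, (N.map (inl : G →* Hol)).lowerCentralSeries k ≤
        actionSeries (inl : G →* Hol).range inr.range (k + 1) := fun k => by
      rw [← actionSeries_one_eq_map_commutatorAction]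
      induction k with
      | zero => exact le_rfl
      | succ k ih =>
        exact (commutator_mono ih le_rfl).trans (commutator_actionSeries_le _ _ (k + 1) 1)
    have h1 := hle (n + p - 2)
    rw [hbot, ← map_lowerCentralSeries, ← top_subtype_lowerCentralSeries, le_bot_iff,
      map_eq_bot_iff_of_injective _ inl_injective,
      map_eq_bot_iff_of_injective _ N.subtype_injective] at h1
    exact h1

end PCentralAutomorphisms

theorem mainTheorem1 (p : ℕ) [Fact p.Prime] (G : Type*) [Group G] [Finite G] (hG : IsPGroup p G)
    (A : Subgroup (MulAut G)) (hA : ActsPCentrallyOn p A (gammaAction p G A)) :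
    (∀ i : ℕ, 1 ≤ i →
      ∃ K : Subgroup (commutatorAction G A),
        (K : Set (commutatorAction G A)) = {x | orderOf x ∣ p ^ i}) ∧
    (∀ i : ℕ, 1 ≤ i → ∃ B : Subgroup A, (B : Set A) = {a | orderOf a ∣ p ^ i}) ∧
    Monoid.exponent (commutatorAction G A) = Monoid.exponent A ∧
    ∃ n : ℕ, Monoid.exponent A = p ^ n ∧
      Group.IsNilpotent A ∧ Group.nilpotencyClass A ≤ n + p - 2 ∧
      Group.IsNilpotent (commutatorAction G A) ∧
      Group.nilpotencyClass (commutatorAction G A) ≤ n + p - 2 := by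
  have hfin : Finite (MulAut G) := Finite.of_injective _ (DFunLike.coe_injective (F := MulAut G))
  have hAp : IsPGroup p A := isPGroup_of_actsPCentrallyOn hG hA
  have hNp : IsPGroup p (commutatorAction G A) := hG.to_subgroup _
  have hexp : ∀ i, (∀ a : A, a ^ p ^ i = 1) ↔ ∀ x : commutatorAction G A, x ^ p ^ i = 1 := by
    intro i
    obtain ⟨K, hK, -⟩ := exists_subgroup_pow_eq_one hG hA i
    constructor
    · intro h x
      have hle : commutatorAction G A ≤ K := (Subgroup.closure_le _).2 (by
        rintro _ ⟨g, a, rfl⟩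
        exact (hK _).2 ⟨inv_mul_smul_mem_commutatorAction g a,
          (pow_eq_one_iff_forall_smul hG hA i a).1 (h a) g⟩)
      exact Subtype.ext ((hK _).1 (hle x.2)).2
    · intro h a
      refine (pow_eq_one_iff_forall_smul hG hA i a).2 fun g => ?_
      simpa [Subtype.ext_iff] using h ⟨_, inv_mul_smul_mem_commutatorAction g a⟩
  have hexp' : ∀ i, Monoid.exponent A ∣ p ^ i ↔
      Monoid.exponent (commutatorAction G A) ∣ p ^ i := fun i => by
    rw [Monoid.exponent_dvd_iff_forall_pow_eq_one, Monoid.exponent_dvd_iff_forall_pow_eq_one, hexp]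
  have hpow : ∀ (H : Type _) [Group H] [Finite H], IsPGroup p H →
      ∃ n, Monoid.exponent H = p ^ n := fun H _ _ hH => by
    obtain ⟨m, hm⟩ := hH.exists_card_eq
    obtain ⟨n, -, hn⟩ := (Nat.dvd_prime_pow Fact.out).1 (hm ▸ Group.exponent_dvd_nat_card (G := H))
    exact ⟨n, hn⟩
  obtain ⟨n, hn⟩ := hpow A hAp
  obtain ⟨m, hm⟩ := hpow _ hNp
  have hmn : Monoid.exponent (commutatorAction G A) = Monoid.exponent A :=
    Nat.dvd_antisymm (hn ▸ (hexp' n).1 hn.dvd) (hm ▸ (hexp' m).2 hm.dvd)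
  have hnilA : Group.IsNilpotent A := hAp.isNilpotent
  have hnilN : Group.IsNilpotent (commutatorAction G A) := hNp.isNilpotent
  have hlcs := lowerCentralSeries_eq_bot_of_actsPCentrallyOn hG hA (n := n) fun x hx => by
    have := Monoid.exponent_dvd_iff_forall_pow_eq_one.1 (hmn.trans hn).dvd ⟨x, hx⟩
    simpa [Subtype.ext_iff] using this
  refine ⟨fun i _ => ?_, fun i _ => ?_, hmn, n, hn, hnilA,
    Subgroup.lowerCentralSeries_eq_bot_iff_nilpotencyClass_le.1 hlcs.1, hnilN,
    Subgroup.lowerCentralSeries_eq_bot_iff_nilpotencyClass_le.1 hlcs.2⟩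
  · obtain ⟨K, hK, -⟩ := exists_subgroup_pow_eq_one hG hA i
    refine ⟨K.subgroupOf _, Set.ext fun x => ?_⟩
    rw [SetLike.mem_coe, Subgroup.mem_subgroupOf, hK, and_iff_right x.2, Set.mem_ofPred_eq,
      orderOf_dvd_iff_pow_eq_one, Subtype.ext_iff, Subgroup.coe_pow, Subgroup.coe_one]
  · obtain ⟨K, hK, hKA⟩ := exists_subgroup_pow_eq_one hG hA i
    have hiff : ∀ a : A, a ^ p ^ i = 1 ↔ ∀ g : G, g⁻¹ * a • g ∈ K := fun a => by
      rw [pow_eq_one_iff_forall_smul hG hA i a]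
      exact forall_congr' fun g => by
        rw [hK, and_iff_right (inv_mul_smul_mem_commutatorAction g a)]
    refine ⟨{ carrier := {a | a ^ p ^ i = 1}
              one_mem' := one_pow _
              mul_mem' := fun {a b} ha hb => (hiff _).2 fun g => ?_
              inv_mem' := fun {a} ha => ?_ }, Set.ext fun a => ?_⟩
    -- Cocycle identity: `g⁻¹ * (a * b) • g = (g⁻¹ * a • g) * a • (g⁻¹ * b • g)`, with `K` invariant
    -- under `A`.
    · have := mul_mem ((hiff a).1 ha g) (hKA _ ((hiff b).1 hb g) a)
      simpa [mul_smul] using this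
    · change (a⁻¹) ^ p ^ i = 1
      rw [inv_pow, show a ^ p ^ i = 1 from ha, inv_one]
    · exact orderOf_dvd_iff_pow_eq_one.symm
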